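/- Let $\mathcal H_1=\mathbb C^d$ and let $\mathcal H_N=\bigwedge^N\mathcal H_1$ be the $N$-fermion Hilbert space, of dimension $D=\binom dN$. Let $\boldsymbol w=(w_1,\dots,w_D)$ with $w_1\ge w_2\ge\dots\ge w_D\ge 0$ and $\sum_j w_j=1$ have exactly $r=3$ nonzero entries, i.e. $w_1\ge w_2\ge w_3>0$ and $w_j=0$ for $j>3$ (so $D\ge 3$, hence $1\le N<d$). Let $\mathcal E^N(\boldsymbol w)$ be the set of density operators $\Gamma$ on $\mathcal H_N$ ($\Gamma\ge 0$, $\operatorname{Tr}\Gamma=1$) whose decreasingly ordered spectrum, counted with multiplicity, is $\boldsymbol w$. Let $\mathcal E^1_N(\boldsymbol w)=N\,\mathrm{Tr}_{N-1}[\mathcal E^N(\boldsymbol w)]$ be the set of the one-particle reduced density operators of these states, the partial trace being over all particles but one. An operator $\gamma$ on $\mathcal H_1$ is called relaxed $\boldsymbol w$-ensemble $N$-representable if $\gamma$ lies in the convex hull $\overline{\mathcal E}{}^1_N(\boldsymbol w)=\operatorname{conv}\big(\mathcal E^1_N(\boldsymbol w)\big)$. Then for all $N$ and $d$, a positive semidefinite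 operator $\gamma$ on $\mathcal H_1$ with decreasingly ordered eigenvalues (natural occupation numbers) $\lambda_1\ge\lambda_2\ge\dots\ge\lambda_d\ge 0$, counted with multiplicity, is relaxed $\boldsymbol w$-ensemble $N$-representable if and only if $$\sum_{j=1}^d\lambda_j=N,\qquad \lambda_1\le 1,\qquad \sum_{j=1}^N\lambda_j\le N-1+w_1,$$ $$2\sum_{j=1}^{N-1}\lambda_j+\lambda_N+\lambda_{N+1}\le 2(N-1)+w_1+w_2 .$$ -/

import Mathlib

noncomputable section

namespace RDMFT

/-- The `d`-dimensional one-particle Hilbert space `ℋ₁ = ℂ^d`. -/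
abbrev OneParticle (d : ℕ) : Type := EuclideanSpace ℂ (Fin d)

/-- The space of `N` distinguishable particles `ℋ₁ ⊗ ⋯ ⊗ ℋ₁`, realised as wave functions
`ψ (x₁, …, x_N)` of `N` one-particle indices, with the Hilbert space structure for which the
product basis `e_{x₁} ⊗ ⋯ ⊗ e_{x_N}` is orthonormal. -/
abbrev NParticle (N d : ℕ) : Type := EuclideanSpace ℂ (Fin N → Fin d)

/-- The `N`-fermion Hilbert space `⋀^N ℋ₁`: the totally antisymmetric wave functions. -/
def Fermion (N d : ℕ) : Submodule ℂ (NParticle N d) where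
  carrier := {ψ | ∀ (σ : Equiv.Perm (Fin N)) (x : Fin N → Fin d),
    ψ (x ∘ σ) = ((Equiv.Perm.sign σ : ℤ) : ℂ) * ψ x}
  zero_mem' := by intro σ x; simp
  add_mem' := by
    intro ψ φ hψ hφ σ x
    simp only [PiLp.add_apply, hψ σ x, hφ σ x, mul_add]
  smul_mem' := by
    intro c ψ hψ σ x
    simp only [PiLp.smul_apply, smul_eq_mul, hψ σ x]
    ring

/-- The values of an alternating form on the standard basis, as a wave function. -/
def alternatingToNParticle (N d : ℕ) :
    ((Fin d → ℂ) [⋀^Fin N]→ₗ[ℂ] ℂ) →ₗ[ℂ] NParticle N d where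
  toFun f := WithLp.toLp 2 fun x => f fun i => Pi.single (x i) 1
  map_add' f g := by ext x; simp
  map_smul' c f := by ext x; simp

theorem alternatingToNParticle_injective (N d : ℕ) :
    Function.Injective (alternatingToNParticle N d) := by
  intro f g h
  refine Module.Basis.ext_alternating (Pi.basisFun ℂ (Fin d)) fun v _ => ?_
  have := congrArg (fun ψ : NParticle N d => ψ v) h
  simpa [alternatingToNParticle] using this

theorem range_alternatingToNParticle (N d : ℕ) :
    LinearMap.range (alternatingToNParticle N d) = Fermion N d := by
  apply le_antisymm
  · rintro _ ⟨f, rfl⟩ σ x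
    have := f.map_perm (fun i => (Pi.single (x i) 1 : Fin d → ℂ)) σ
    simpa [alternatingToNParticle, Function.comp_def, Units.smul_def] using this
  · intro ψ hψ
    let m : MultilinearMap ℂ (fun _ : Fin N => (Fin d → ℂ)) ℂ :=
      ∑ x : Fin N → Fin d, ψ x •
        (MultilinearMap.mkPiAlgebra ℂ (Fin N) ℂ).compLinearMap
          (fun i => LinearMap.proj (x i))
    have hm : ∀ y : Fin N → Fin d,
        m (fun i => Pi.single (y i) 1) = ψ y := by
      intro y
      simp only [m, sum_apply, smul_apply,
        MultilinearMap.compLinearMap_apply, MultilinearMap.mkPiAlgebra_apply,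
        LinearMap.proj_apply, smul_eq_mul]
      rw [Finset.sum_eq_single y]
      · simp
      · intro x _ hxy
        obtain ⟨i, hi⟩ := Function.ne_iff.mp hxy
        rw [Finset.prod_eq_zero (Finset.mem_univ i) (by simp [hi]), mul_zero]
      · simp
    refine ⟨((N.factorial : ℂ)⁻¹) • MultilinearMap.alternatization m, ?_⟩
    ext x
    have hN : (N.factorial : ℂ) ≠ 0 := by exact_mod_cast N.factorial_ne_zero
    have key : ∀ σ : Equiv.Perm (Fin N),
        Equiv.Perm.sign σ • m (fun i => Pi.single (x (σ i)) (1 : ℂ)) = ψ x := by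
      intro σ
      have h1 := hm (x ∘ σ)
      simp only [Function.comp_apply] at h1
      rw [h1, hψ σ x, Units.smul_def, zsmul_eq_mul, ← mul_assoc,
        ← Int.cast_mul]
      simp
    simp only [alternatingToNParticle, LinearMap.coe_mk, AddHom.coe_mk,
      AlternatingMap.smul_apply, MultilinearMap.alternatization_apply,
      MultilinearMap.domDomCongr_apply, key]
    simp [Fintype.card_perm, hN]

/-- `dim ⋀^N ℋ₁ = binom(d, N)`. -/
theorem finrank_fermion (N d : ℕ) : Module.finrank ℂ (Fermion N d) = d.choose N := by
  rw [← range_alternatingToNParticle,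
    LinearMap.finrank_range_of_inj (alternatingToNParticle_injective N d),
    (exteriorPower.alternatingMapLinearEquiv (R := ℂ) (M := Fin d → ℂ) (N := ℂ)
      (n := N)).finrank_eq, Module.finrank_linearMap, exteriorPower.finrank_eq]
  simp

/-- Operators on the `N`-fermion Hilbert space. -/
abbrev FermionOp (N d : ℕ) : Type := Fermion N d →ₗ[ℂ] Fermion N d

/-- Operators on the one-particle Hilbert space. -/
abbrev OneParticleOp (d : ℕ) : Type := OneParticle d →ₗ[ℂ] OneParticle d

/-- The matrix `⟨x₁ ⋯ x_N| Γ |y₁ ⋯ y_N⟩` of an operator on the `N`-fermion space, extended by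
zero to the orthogonal complement of the antisymmetric wave functions. -/
def kernelMatrix {N d : ℕ} (Γ : FermionOp N d) :
    Matrix (Fin N → Fin d) (Fin N → Fin d) ℂ :=
  Matrix.toEuclideanLin.symm
    ((Fermion N d).subtype ∘ₗ Γ ∘ₗ (Fermion N d).orthogonalProjectionOnto.toLinearMap)

/-- The partial trace over all particles except the first one. -/
def partialTrace {M d : ℕ} (A : Matrix (Fin (M + 1) → Fin d) (Fin (M + 1) → Fin d) ℂ) :
    Matrix (Fin d) (Fin d) ℂ :=
  Matrix.of fun i j => ∑ x : Fin M → Fin d,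
    A (Fin.cons i x : Fin (M + 1) → Fin d) (Fin.cons j x : Fin (M + 1) → Fin d)

/-- The one-particle reduced operator `N Tr_{N-1}[Γ]` (zero if there is no particle). -/
def oneRDM {d : ℕ} : {N : ℕ} → FermionOp N d → OneParticleOp d
  | 0, _ => 0
  | M + 1, Γ => Matrix.toEuclideanLin (((M + 1 : ℕ) : ℂ) • partialTrace (kernelMatrix Γ))

/-- The density operators on the `N`-fermion Hilbert space. -/
def ensembleStates (N d : ℕ) : Set (FermionOp N d) :=
  {Γ | LinearMap.IsPositive (𝕜 := ℂ) (E := Fermion N d) Γ ∧ LinearMap.trace ℂ (Fermion N d) Γ = 1}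

/-- The `N`-fermion density operators whose decreasingly ordered spectrum, counted with
multiplicity, is `w`. -/
def wEnsembleStates {N d : ℕ} (w : Fin (d.choose N) → ℝ) : Set (FermionOp N d) :=
  {Γ | ∃ h : Γ ∈ ensembleStates N d,
    h.1.isSymmetric.eigenvalues (finrank_fermion N d) = w}

/-- The `w`-ensemble `N`-representable one-particle reduced density operators. -/
def wRepresentable {N d : ℕ} (w : Fin (d.choose N) → ℝ) : Set (OneParticleOp d) :=
  oneRDM '' wEnsembleStates w

/-- The relaxed `w`-ensemble `N`-representable one-particle reduced density operators. -/
def relaxedWRepresentable {N d : ℕ} (w : Fin (d.choose N) → ℝ) : Set (OneParticleOp d) :=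
  convexHull ℝ (wRepresentable w)

/-- Decreasingly ordered ensemble weights: `w₁ ≥ w₂ ≥ ⋯ ≥ w_D ≥ 0` with sum one. -/
structure IsWeightVector {D : ℕ} (w : Fin D → ℝ) : Prop where
  antitone : Antitone w
  nonneg : ∀ j, 0 ≤ w j
  sum_eq_one : ∑ j, w j = 1

/-- The entry `v_k` of a vector `(v₁, …, v_n)`, with indices starting at one (and the value `0`
for an index outside `1, …, n`). -/
def entry {n : ℕ} (v : Fin n → ℝ) (k : ℕ) : ℝ :=
  if h : 1 ≤ k ∧ k ≤ n then v ⟨k - 1, by omega⟩ else 0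

/-- The `k`-th natural occupation number `λ_k`, in decreasing order and counted with multiplicity:
the `k`-th largest eigenvalue of a self-adjoint one-particle operator, `k = 1, …, d`. -/
def occ {d : ℕ} {γ : OneParticleOp d} (hγ : γ.IsSymmetric) (k : ℕ) : ℝ :=
  entry (hγ.eigenvalues finrank_euclideanSpace_fin) k

end RDMFT

end

noncomputable section

namespace RDMFT

open Finset

variable {N d : ℕ}

/-! Write `N = K + 1` and index orbitals from 0. In the Slater basis built on an orthonormal
eigenbasis of `γ`, the diagonal of a reduced operator depends only on the diagonal weights `p_I` of
`Γ`: orbital `i` receives the sum of `p_I` over `I ∋ i` (`inner_oneRDM_self`).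

Necessity. A linear functional `c` of the occupations becomes a `p`-average of the sums of `c` over
configurations. If these sums are at most `B`, and at most `B + 1` on a set `s`, the average is at
most `B` plus the `p`-weight of `s`, which a Ky Fan type bound controls by the `|s|` largest weights
(`sum_inner_le_of_eigenvalues`, `sum_mul_eigenvalues_le`). The inequalities come from `|s| = 0, 1,
2`. Since the eigenbasis of `γ` stays fixed while `Γ` varies, the bounds pass to the convex hull.

Sufficiency. Placing the weights on Slater determinants in any order gives a diagonal representable
operator, so it suffices to put the eigenvalue vector into the hull of the resulting occupation
vectors. Otherwise a functional `c` separates it strictly; by rearrangement `c` may be taken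
decreasing. For such `c` the two best configurations add orbital `K` or `K + 1` to the lowest `K`,
and the third either adds `K + 2` instead, or drops `K - 1` and keeps both `K` and `K + 1`. In each
case the assumed inequalities, with suitable nonnegative multipliers, bound the value of `c` by that
of the corresponding three-determinant mixture (`exists_configs_ge`), a contradiction. -/

/-- The inner product inherited from the `N`-particle space (a shortcut that takes precedence over
the `CStarModule` structure). -/
instance instInnerFermion : Inner ℂ (Fermion N d) := InnerProductSpace.toInner

/-! ### Product states and Slater determinants -/

/-- The product wave function `u_{y₁} ⊗ ⋯ ⊗ u_{y_N}`. -/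
def prodState (u : OrthonormalBasis (Fin d) ℂ (OneParticle d)) (y : Fin N → Fin d) :
    NParticle N d :=
  WithLp.toLp 2 fun x => ∏ k, u (y k) (x k)

theorem inner_prodState (u : OrthonormalBasis (Fin d) ℂ (OneParticle d)) (y z : Fin N → Fin d) :
    inner ℂ (prodState u y) (prodState u z) = if y = z then 1 else 0 := by
  have h : inner ℂ (prodState u y) (prodState u z) = ∏ k, inner ℂ (u (y k)) (u (z k)) := by
    simp only [PiLp.inner_apply, prodState, RCLike.inner_apply, map_prod, ← prod_mul_distrib]
    rw [prod_univ_sum, Fintype.piFinset_univ]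
  simp only [h, u.inner_eq_ite]
  split_ifs with hyz
  · simp [hyz]
  · obtain ⟨k, hk⟩ := Function.ne_iff.mp hyz
    exact prod_eq_zero (mem_univ k) (by simp [hk])

theorem orthonormal_prodState (u : OrthonormalBasis (Fin d) ℂ (OneParticle d)) :
    Orthonormal ℂ (prodState (N := N) u) :=
  orthonormal_iff_ite.2 fun y z => inner_prodState u y z

/-- The product basis of the `N`-particle space. -/
def prodBasis (N : ℕ) (u : OrthonormalBasis (Fin d) ℂ (OneParticle d)) :
    OrthonormalBasis (Fin N → Fin d) ℂ (NParticle N d) :=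
  OrthonormalBasis.mk (orthonormal_prodState u)
    ((orthonormal_prodState u).linearIndependent.span_eq_top_of_card_eq_finrank' (by simp)).ge

@[simp]
theorem prodBasis_apply (u : OrthonormalBasis (Fin d) ℂ (OneParticle d)) (y : Fin N → Fin d) :
    prodBasis N u y = prodState u y := by
  simp [prodBasis]

theorem prodState_comp_perm (u : OrthonormalBasis (Fin d) ℂ (OneParticle d)) (y x : Fin N → Fin d)
    (σ : Equiv.Perm (Fin N)) : prodState u y (x ∘ σ) = prodState u (y ∘ ⇑σ⁻¹) x := by
  simp only [prodState, Function.comp_apply]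
  rw [← Equiv.prod_comp σ (fun k => u (y (σ⁻¹ k)) (x k))]
  simp

/-- The `N`-element sets of one-particle indices. -/
abbrev Config (N d : ℕ) : Type := {I : Finset (Fin d) // I.card = N}

/-- The increasing enumeration of a configuration. -/
def Config.enum (I : Config N d) : Fin N → Fin d := I.1.orderEmbOfFin I.2

theorem Config.enum_injective (I : Config N d) : Function.Injective I.enum :=
  (I.1.orderEmbOfFin I.2).injective

theorem Config.image_enum (I : Config N d) : univ.image I.enum = I.1 := by
  rw [← Finset.coe_inj, coe_image, coe_univ, Set.image_univ]
  exact Finset.range_orderEmbOfFin I.1 I.2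

theorem Config.image_enum_comp (I : Config N d) (σ : Equiv.Perm (Fin N)) :
    univ.image (I.enum ∘ σ) = I.1 := by
  rw [← image_image, image_univ_of_surjective σ.surjective, I.image_enum]

/-- The sign of a permutation, as a complex number. -/
def csign (σ : Equiv.Perm (Fin N)) : ℂ := ((Equiv.Perm.sign σ : ℤ) : ℂ)

theorem csign_mul_self (σ : Equiv.Perm (Fin N)) : csign σ * csign σ = 1 := by
  rw [csign, ← Int.cast_mul]; simp

@[simp]
theorem star_csign (σ : Equiv.Perm (Fin N)) : (starRingEnd ℂ) (csign σ) = csign σ := by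
  simp [csign]

theorem csign_mul (σ τ : Equiv.Perm (Fin N)) : csign (σ * τ) = csign σ * csign τ := by
  simp [csign]

/-- The Slater determinant of the orbitals `u_i`, `i ∈ I`. -/
def slater (u : OrthonormalBasis (Fin d) ℂ (OneParticle d)) (I : Config N d) : Fermion N d :=
  ⟨((√(N.factorial : ℝ) : ℂ))⁻¹ • ∑ σ : Equiv.Perm (Fin N), csign σ • prodState u (I.enum ∘ σ), by
    refine Submodule.smul_mem _ _ fun τ x => ?_
    change _ = csign τ * _
    simp only [WithLp.ofLp_sum, Finset.sum_apply, prodState_comp_perm, smul_eq_mul,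
      mul_sum, WithLp.ofLp_smul, Pi.smul_apply]
    rw [← Equiv.sum_comp (Equiv.mulRight τ)]
    refine sum_congr rfl fun σ _ => ?_
    have h : (I.enum ∘ ⇑(Equiv.mulRight τ σ)) ∘ ⇑τ⁻¹ = I.enum ∘ σ := by
      funext k; simp
    rw [h, Equiv.coe_mulRight, csign_mul]
    ring⟩

theorem inner_prodState_slater (u : OrthonormalBasis (Fin d) ℂ (OneParticle d))
    (y : Fin N → Fin d) (I : Config N d) :
    inner ℂ (prodState u y) (slater u I : NParticle N d) =
      (√(N.factorial : ℝ) : ℂ)⁻¹ *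
        ∑ σ : Equiv.Perm (Fin N), csign σ * if y = I.enum ∘ σ then 1 else 0 := by
  simp only [slater, inner_smul_right, inner_sum, inner_prodState]

theorem inner_prodState_slater_enum (u : OrthonormalBasis (Fin d) ℂ (OneParticle d))
    (I : Config N d) (τ : Equiv.Perm (Fin N)) :
    inner ℂ (prodState u (I.enum ∘ τ)) (slater u I : NParticle N d) =
      (√(N.factorial : ℝ) : ℂ)⁻¹ * csign τ := by
  rw [inner_prodState_slater, sum_eq_single τ]
  · simp
  · intro σ _ hσ
    rw [if_neg, mul_zero]
    intro h
    exact hσ (Equiv.ext fun k => (I.enum_injective (congrFun h k)).symm)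
  · simp

theorem inner_prodState_slater_of_image_ne (u : OrthonormalBasis (Fin d) ℂ (OneParticle d))
    {y : Fin N → Fin d} {I : Config N d} (h : univ.image y ≠ I.1) :
    inner ℂ (prodState u y) (slater u I : NParticle N d) = 0 := by
  rw [inner_prodState_slater, sum_eq_zero, mul_zero]
  intro σ _
  rw [if_neg, mul_zero]
  rintro rfl
  exact h (I.image_enum_comp σ)

theorem sqrt_factorial_inv_mul_self (N : ℕ) :
    (√(N.factorial : ℝ) : ℂ)⁻¹ * (√(N.factorial : ℝ) : ℂ)⁻¹ = (N.factorial : ℂ)⁻¹ := by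
  rw [← mul_inv, ← Complex.ofReal_mul, Real.mul_self_sqrt (by positivity)]
  simp

theorem inner_slater (u : OrthonormalBasis (Fin d) ℂ (OneParticle d)) (I J : Config N d) :
    inner ℂ (slater u I) (slater u J) = if I = J then 1 else 0 := by
  rw [Submodule.coe_inner]
  conv_lhs => enter [2]; rw [slater]
  simp only [inner_smul_left, sum_inner, star_csign]
  split_ifs with h
  · subst h
    simp only [inner_prodState_slater_enum, map_inv₀, Complex.conj_ofReal]
    have : ∀ σ : Equiv.Perm (Fin N), csign σ * ((√(N.factorial : ℝ) : ℂ)⁻¹ * csign σ) =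
        (√(N.factorial : ℝ) : ℂ)⁻¹ := fun σ => by
      rw [mul_left_comm, csign_mul_self, mul_one]
    simp only [this, sum_const, card_univ, Fintype.card_perm, Fintype.card_fin, nsmul_eq_mul]
    rw [mul_left_comm, sqrt_factorial_inv_mul_self]
    exact mul_inv_cancel₀ (by exact_mod_cast N.factorial_ne_zero)
  · rw [sum_eq_zero, mul_zero]
    intro σ _
    rw [inner_prodState_slater_of_image_ne, mul_zero]
    rw [I.image_enum_comp]
    exact fun h' => h (Subtype.ext h')

theorem orthonormal_slater (u : OrthonormalBasis (Fin d) ℂ (OneParticle d)) :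
    Orthonormal ℂ (slater (N := N) u) :=
  orthonormal_iff_ite.2 fun y z => inner_slater u y z

/-- The orthonormal basis of the `N`-fermion space by Slater determinants. -/
def slaterBasis (N : ℕ) (u : OrthonormalBasis (Fin d) ℂ (OneParticle d)) :
    OrthonormalBasis (Config N d) ℂ (Fermion N d) :=
  OrthonormalBasis.mk (orthonormal_slater u)
    ((orthonormal_slater u).linearIndependent.span_eq_top_of_card_eq_finrank' (by
      rw [finrank_fermion]; simp)).ge

@[simp]
theorem slaterBasis_apply (u : OrthonormalBasis (Fin d) ℂ (OneParticle d)) (I : Config N d) :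
    slaterBasis N u I = slater u I := by
  simp [slaterBasis]

theorem ext_inner_slaterBasis (u : OrthonormalBasis (Fin d) ℂ (OneParticle d))
    {φ ψ : Fermion N d} (h : ∀ I, inner ℂ (slaterBasis N u I) φ = inner ℂ (slaterBasis N u I) ψ) :
    φ = ψ :=
  (slaterBasis N u).repr.injective <| PiLp.ext fun I => by
    simpa only [OrthonormalBasis.repr_apply_apply] using h I

theorem inner_slater_proj (u : OrthonormalBasis (Fin d) ℂ (OneParticle d)) (I : Config N d)
    (ψ : NParticle N d) :
    inner ℂ (slater u I) ((Fermion N d).orthogonalProjectionOnto ψ) =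
      inner ℂ (slater u I : NParticle N d) ψ :=
  Submodule.inner_orthogonalProjectionOnto_eq_of_mem_left (slater u I) ψ

/-- Pauli exclusion: a repeated orbital makes the product state orthogonal to every Slater
determinant. -/
theorem proj_prodState_eq_zero (u : OrthonormalBasis (Fin d) ℂ (OneParticle d))
    {y : Fin N → Fin d} (hy : ¬ Function.Injective y) :
    (Fermion N d).orthogonalProjectionOnto (prodState u y) = 0 := by
  refine ext_inner_slaterBasis u fun I => ?_
  simp only [slaterBasis_apply, inner_zero_right]
  rw [inner_slater_proj, inner_eq_zero_symm, inner_prodState_slater_of_image_ne]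
  intro h
  refine hy (Set.injOn_univ.1 (coe_univ (α := Fin N) ▸ card_image_iff.1 ?_))
  rw [h, I.2, card_fin]

/-- The configuration occupied by an injective family of one-particle indices. -/
def configOf (y : Fin N → Fin d) (hy : Function.Injective y) : Config N d :=
  ⟨univ.image y, by rw [card_image_of_injective _ hy, card_fin]⟩

theorem exists_eq_enum_comp {y : Fin N → Fin d} (hy : Function.Injective y) :
    ∃ σ : Equiv.Perm (Fin N), y = (configOf y hy).enum ∘ σ := by
  have h : ∀ k, ∃ l, (configOf y hy).enum l = y k := fun k => by
    have : y k ∈ univ.image (configOf y hy).enum := by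
      rw [Config.image_enum]; simp [configOf]
    simpa using this
  choose f hf using h
  have hfi : Function.Injective f := fun a b hab => hy (by rw [← hf a, ← hf b, hab])
  exact ⟨Equiv.ofBijective f (Finite.injective_iff_bijective.1 hfi), funext fun k => (hf k).symm⟩

/-- Only the modulus of `c` is recorded: the sign of the ordering cancels in diagonal matrix
elements. -/
theorem proj_prodState (u : OrthonormalBasis (Fin d) ℂ (OneParticle d))
    {y : Fin N → Fin d} (hy : Function.Injective y) :
    ∃ c : ℂ, (starRingEnd ℂ) c * c = (N.factorial : ℂ)⁻¹ ∧
      (Fermion N d).orthogonalProjectionOnto (prodState u y) = c • slater u (configOf y hy) := by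
  obtain ⟨σ, hσ⟩ := exists_eq_enum_comp hy
  refine ⟨(√(N.factorial : ℝ) : ℂ)⁻¹ * csign σ, ?_, ?_⟩
  · simp only [map_mul, map_inv₀, Complex.conj_ofReal, star_csign]
    rw [mul_mul_mul_comm, csign_mul_self, sqrt_factorial_inv_mul_self, mul_one]
  · refine ext_inner_slaterBasis u fun I => ?_
    have h := inner_smul_right (𝕜 := ℂ) (slater u I) (slater u (configOf y hy))
      ((√(N.factorial : ℝ) : ℂ)⁻¹ * csign σ)
    simp only [slaterBasis_apply]
    rw [h]
    rw [inner_slater, inner_slater_proj, ← inner_conj_symm]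
    split_ifs with h
    · have h2 : y = I.enum ∘ σ := by rw [h]; exact hσ
      rw [h2, inner_prodState_slater_enum]
      simp
    · rw [inner_prodState_slater_of_image_ne]
      · simp
      · exact fun h' => h (Subtype.ext h'.symm)

theorem fermion_inner_smul_right (φ ψ : Fermion N d) (c : ℂ) :
    inner ℂ φ (c • ψ) = c * inner ℂ φ ψ :=
  inner_smul_right (𝕜 := ℂ) φ ψ c

theorem fermion_inner_smul_left (φ ψ : Fermion N d) (c : ℂ) :
    inner ℂ (c • φ) ψ = (starRingEnd ℂ) c * inner ℂ φ ψ :=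
  inner_smul_left (𝕜 := ℂ) φ ψ c

/-! ### Matrix elements of the one-particle reduced operator -/

/-- The map `f ↦ v ⊗ f` adding a first particle in the state `v`. -/
def addParticle {M : ℕ} (v : OneParticle d) : NParticle M d →ₗ[ℂ] NParticle (M + 1) d where
  toFun f := WithLp.toLp 2 fun x => v (x 0) * f (Fin.tail x)
  map_add' f g := by ext x; simp [mul_add]
  map_smul' c f := by ext x; simp [mul_left_comm]

theorem addParticle_prodState {M : ℕ} (u : OrthonormalBasis (Fin d) ℂ (OneParticle d)) (i : Fin d)
    (z : Fin M → Fin d) :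
    addParticle (u i) (prodState u z) = prodState u (Fin.cons i z : Fin (M + 1) → Fin d) := by
  ext x
  simp [addParticle, prodState, Fin.prod_univ_succ, Fin.tail]

theorem addParticle_single {M : ℕ} (v : OneParticle d) (x : Fin M → Fin d) :
    addParticle v (EuclideanSpace.single x 1) =
      ∑ a, v a • EuclideanSpace.single (Fin.cons a x : Fin (M + 1) → Fin d) (1 : ℂ) := by
  ext y
  obtain ⟨b, z, rfl⟩ : ∃ b z, y = (Fin.cons b z : Fin (M + 1) → Fin d) :=
    ⟨y 0, Fin.tail y, (Fin.cons_self_tail y).symm⟩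
  simp only [addParticle, LinearMap.coe_mk, AddHom.coe_mk, Fin.cons_zero, Fin.tail_cons,
    WithLp.ofLp_sum, Finset.sum_apply, WithLp.ofLp_smul, Pi.smul_apply, PiLp.single_apply,
    Fin.cons_inj, smul_eq_mul]
  rw [sum_eq_single b]
  · simp
  · intro a _ hab
    simp [hab.symm]
  · simp

/-- An operator on the fermion space, extended by zero to the `N`-particle space. -/
def extendOp (Γ : FermionOp N d) : NParticle N d →ₗ[ℂ] NParticle N d :=
  (Fermion N d).subtype ∘ₗ Γ ∘ₗ (Fermion N d).orthogonalProjectionOnto.toLinearMap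

theorem inner_extendOp (Γ : FermionOp N d) (φ ψ : NParticle N d) :
    inner ℂ φ (extendOp Γ ψ) = inner ℂ ((Fermion N d).orthogonalProjectionOnto φ)
      (Γ ((Fermion N d).orthogonalProjectionOnto ψ)) :=
  (Submodule.inner_orthogonalProjectionOnto_eq_of_mem_right
    (Γ ((Fermion N d).orthogonalProjectionOnto ψ)) φ).symm

theorem inner_single_toEuclideanLin {ι : Type*} [Fintype ι] [DecidableEq ι]
    (T : EuclideanSpace ℂ ι →ₗ[ℂ] EuclideanSpace ℂ ι) (x y : ι) :
    Matrix.toEuclideanLin.symm T x y =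
      inner ℂ (EuclideanSpace.single x (1 : ℂ)) (T (EuclideanSpace.single y 1)) := by
  obtain ⟨A, rfl⟩ := Matrix.toEuclideanLin.surjective T
  simp [Matrix.toEuclideanLin, Matrix.toLpLin_apply, EuclideanSpace.inner_single_left]

/-- Both sides are the trace of `S† T`. This makes the partial trace computable in any orbital
basis. -/
theorem sum_inner_basis_independent {E F ι κ : Type*} [NormedAddCommGroup E]
    [InnerProductSpace ℂ E] [NormedAddCommGroup F] [InnerProductSpace ℂ F]
    [FiniteDimensional ℂ E] [FiniteDimensional ℂ F] [Fintype ι] [Fintype κ]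
    (b : OrthonormalBasis ι ℂ E) (b' : OrthonormalBasis κ ℂ E) (S T : E →ₗ[ℂ] F) :
    ∑ i, inner ℂ (S (b i)) (T (b i)) = ∑ k, inner ℂ (S (b' k)) (T (b' k)) := by
  have h := LinearMap.trace_eq_sum_inner (LinearMap.adjoint S ∘ₗ T) b
  rw [LinearMap.trace_eq_sum_inner _ b'] at h
  simpa [LinearMap.adjoint_inner_right] using h.symm

theorem inner_oneRDM {M : ℕ} (Γ : FermionOp (M + 1) d)
    (u : OrthonormalBasis (Fin d) ℂ (OneParticle d)) (i j : Fin d) :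
    inner ℂ (u i) (oneRDM Γ (u j)) = ((M + 1 : ℕ) : ℂ) * ∑ z : Fin M → Fin d,
      inner ℂ ((Fermion (M + 1) d).orthogonalProjectionOnto (prodState u (Fin.cons i z)))
        (Γ ((Fermion (M + 1) d).orthogonalProjectionOnto (prodState u (Fin.cons j z)))) := by
  have h1 : ∀ z : Fin M → Fin d,
      inner ℂ ((Fermion (M + 1) d).orthogonalProjectionOnto (prodState u (Fin.cons i z)))
        (Γ ((Fermion (M + 1) d).orthogonalProjectionOnto (prodState u (Fin.cons j z)))) =
      inner ℂ (addParticle (u i) (prodBasis M u z))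
        ((extendOp Γ ∘ₗ addParticle (u j)) (prodBasis M u z)) := fun z => by
    rw [LinearMap.comp_apply, inner_extendOp, prodBasis_apply, addParticle_prodState,
      addParticle_prodState]
  -- Trade the product basis of `u` for the standard one, in which the partial trace is defined.
  rw [sum_congr rfl fun z _ => h1 z,
    sum_inner_basis_independent _ (EuclideanSpace.basisFun (Fin M → Fin d) ℂ)]
  simp only [EuclideanSpace.basisFun_apply, LinearMap.comp_apply, addParticle_single, map_sum,
    map_smul, sum_inner, inner_sum, inner_smul_left, inner_smul_right]
  simp only [extendOp, ← inner_single_toEuclideanLin]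
  change inner ℂ (u i) (Matrix.toEuclideanLin (((M + 1 : ℕ) : ℂ) • partialTrace (kernelMatrix Γ))
    (u j)) = _
  simp only [PiLp.inner_apply, Matrix.toEuclideanLin, Matrix.toLpLin_apply, Matrix.mulVec,
    dotProduct, Matrix.smul_apply, RCLike.inner_apply, partialTrace, Matrix.of_apply, kernelMatrix,
    sum_mul, mul_sum, smul_eq_mul]
  rw [sum_comm]
  conv_rhs => rw [sum_comm]
  refine sum_congr rfl fun b _ => ?_
  rw [sum_comm]
  refine sum_congr rfl fun x _ => sum_congr rfl fun a _ => ?_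
  ring

/-- A function of configurations, as a function of families of one-particle indices. -/
def liftConfig (g : Config N d → ℂ) (y : Fin N → Fin d) : ℂ :=
  open Classical in if hy : Function.Injective y then g (configOf y hy) else 0

theorem liftConfig_comp_perm (g : Config N d → ℂ) (y : Fin N → Fin d) (σ : Equiv.Perm (Fin N)) :
    liftConfig g (y ∘ σ) = liftConfig g y := by
  unfold liftConfig
  by_cases hy : Function.Injective y
  · rw [dif_pos hy, dif_pos (hy.comp σ.injective)]
    congr 1
    apply Subtype.ext
    simp only [configOf]
    rw [← image_image, image_univ_of_surjective σ.surjective]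
  · rw [dif_neg hy, dif_neg]
    intro h
    exact hy ((Equiv.injective_comp σ y).1 h)

/-- Each configuration is hit by exactly `N!` injective tuples, its orderings. -/
theorem sum_liftConfig (g : Config N d → ℂ) :
    ∑ y, liftConfig g y = (N.factorial : ℂ) * ∑ I, g I := by
  have h : (N.factorial : ℂ) * ∑ I, g I = ∑ p : Config N d × Equiv.Perm (Fin N), g p.1 := by
    rw [Fintype.sum_prod_type, mul_sum]
    simp [Fintype.card_perm]
  rw [h]
  symm
  refine sum_of_injOn (fun p => p.1.enum ∘ p.2) ?_ (by simp [Set.MapsTo]) ?_ ?_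
  · rintro ⟨I, σ⟩ _ ⟨J, τ⟩ _ hp
    have hIJ : I = J := by
      have := congrArg (fun y => univ.image y) hp
      simp only [Config.image_enum_comp] at this
      exact Subtype.ext this
    subst hIJ
    exact Prod.ext rfl (Equiv.ext fun k => I.enum_injective (congrFun hp k))
  · intro y _ hy
    rw [liftConfig, dif_neg]
    intro hi
    obtain ⟨σ, hσ⟩ := exists_eq_enum_comp hi
    exact hy ⟨(configOf y hi, σ), by simp, hσ.symm⟩
  · rintro ⟨I, σ⟩ _
    have hi : Function.Injective (I.enum ∘ σ) := I.enum_injective.comp σ.injective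
    rw [liftConfig, dif_pos hi]
    congr 1
    exact Subtype.ext (I.image_enum_comp σ).symm

/-- By permutation symmetry the prefactor `M + 1` becomes a sum over the position of `i`; an
injective tuple has `i` in at most one position. -/
theorem sum_liftConfig_cons {M : ℕ} (g : Config (M + 1) d → ℂ) (i : Fin d) :
    ((M + 1 : ℕ) : ℂ) * ∑ z : Fin M → Fin d, liftConfig g (Fin.cons i z) =
      ((M + 1).factorial : ℂ) * ∑ I, if i ∈ I.1 then g I else 0 := by
  have h0 : ∑ z : Fin M → Fin d, liftConfig g (Fin.cons i z) =
      ∑ y : Fin (M + 1) → Fin d, if y 0 = i then liftConfig g y else 0 := by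
    rw [← Equiv.sum_comp (Fin.consEquiv fun _ => Fin d), Fintype.sum_prod_type]
    simp only [Fin.consEquiv, Equiv.coe_fn_mk, Fin.cons_zero]
    rw [sum_comm]
    simp
  have hk : ∀ k : Fin (M + 1), (∑ y : Fin (M + 1) → Fin d, if y k = i then liftConfig g y else 0) =
      ∑ y : Fin (M + 1) → Fin d, if y 0 = i then liftConfig g y else 0 := fun k => by
    rw [← Equiv.sum_comp ((Equiv.swap 0 k).arrowCongr (Equiv.refl (Fin d)))]
    refine sum_congr rfl fun y _ => ?_
    have : ((Equiv.swap 0 k).arrowCongr (Equiv.refl (Fin d))) y = y ∘ Equiv.swap 0 k := by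
      funext l; simp [Equiv.arrowCongr]
    rw [this, liftConfig_comp_perm]
    simp
  have hs : ((M + 1 : ℕ) : ℂ) * ∑ z : Fin M → Fin d, liftConfig g (Fin.cons i z) =
      ∑ k : Fin (M + 1), ∑ y : Fin (M + 1) → Fin d, if y k = i then liftConfig g y else 0 := by
    rw [sum_congr rfl fun k _ => hk k, h0]
    simp
  rw [hs, sum_comm, ← sum_liftConfig]
  refine sum_congr rfl fun y _ => ?_
  by_cases hy : Function.Injective y
  · simp only [liftConfig, dif_pos hy, configOf]
    by_cases hi : ∃ k, y k = i
    · obtain ⟨k, rfl⟩ := hi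
      simp [hy.eq_iff]
    · have : ∀ k, y k ≠ i := fun k h => hi ⟨k, h⟩
      simp [this]
  · simp [liftConfig, dif_neg hy]

theorem inner_proj_prodState_self (Γ : FermionOp N d)
    (u : OrthonormalBasis (Fin d) ℂ (OneParticle d)) (y : Fin N → Fin d) :
    inner ℂ ((Fermion N d).orthogonalProjectionOnto (prodState u y))
        (Γ ((Fermion N d).orthogonalProjectionOnto (prodState u y))) =
      liftConfig (fun I => (N.factorial : ℂ)⁻¹ * inner ℂ (slater u I) (Γ (slater u I))) y := by
  by_cases hy : Function.Injective y
  · obtain ⟨c, hc, h⟩ := proj_prodState u hy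
    rw [h, map_smul, fermion_inner_smul_left, fermion_inner_smul_right, ← mul_assoc, hc]
    simp [liftConfig, dif_pos hy]
  · rw [proj_prodState_eq_zero u hy, map_zero, liftConfig, dif_neg hy]
    exact inner_zero_right (𝕜 := ℂ) (0 : Fermion N d)

theorem inner_oneRDM_self (Γ : FermionOp N d) (u : OrthonormalBasis (Fin d) ℂ (OneParticle d))
    (i : Fin d) :
    inner ℂ (u i) (oneRDM Γ (u i)) =
      ∑ I : Config N d, if i ∈ I.1 then inner ℂ (slater u I) (Γ (slater u I)) else 0 := by
  cases N with
  | zero =>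
    rw [sum_eq_zero]
    · simp [oneRDM]
    · intro I _
      rw [if_neg]
      rw [card_eq_zero.1 I.2]
      simp
  | succ M =>
    simp only [inner_oneRDM, inner_proj_prodState_self]
    rw [sum_liftConfig_cons, mul_sum]
    refine sum_congr rfl fun I _ => ?_
    have : ((M + 1).factorial : ℂ) ≠ 0 := by exact_mod_cast (M + 1).factorial_ne_zero
    split_ifs
    · field_simp
    · simp

/-- Moving one particle from `j` to `i ≠ j` changes the configuration, so a `Γ` diagonal in Slater
determinants has no such matrix element. -/
theorem inner_oneRDM_of_ne (Γ : FermionOp N d) (u : OrthonormalBasis (Fin d) ℂ (OneParticle d))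
    {w : Config N d → ℂ} (hΓ : ∀ I, Γ (slater u I) = w I • slater u I) {i j : Fin d}
    (hij : i ≠ j) : inner ℂ (u i) (oneRDM Γ (u j)) = 0 := by
  cases N with
  | zero => simp [oneRDM]
  | succ M =>
    rw [inner_oneRDM, sum_eq_zero, mul_zero]
    intro z _
    by_cases hy : Function.Injective (Fin.cons i z : Fin (M + 1) → Fin d)
    · by_cases hy' : Function.Injective (Fin.cons j z : Fin (M + 1) → Fin d)
      · obtain ⟨c, -, h⟩ := proj_prodState u hy
        obtain ⟨c', -, h'⟩ := proj_prodState u hy'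
        rw [h, h', map_smul, hΓ, fermion_inner_smul_left, fermion_inner_smul_right,
          fermion_inner_smul_right, inner_slater, if_neg]
        · simp
        intro hI
        have hj : j ∈ (configOf _ hy).1 := by
          rw [hI]
          exact mem_image.2 ⟨0, mem_univ _, rfl⟩
        obtain ⟨k, -, hk⟩ := mem_image.1 hj
        rcases Fin.eq_zero_or_eq_succ k with rfl | ⟨l, rfl⟩
        · exact hij hk
        · have := @hy' 0 l.succ (by simpa using hk.symm)
          exact (Fin.succ_ne_zero l) this.symm
      · rw [proj_prodState_eq_zero u hy', map_zero]
        exact inner_zero_right (𝕜 := ℂ) _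
    · rw [proj_prodState_eq_zero u hy]
      exact inner_zero_left (𝕜 := ℂ) _

/-! ### Diagonal operators and a Ky Fan type bound -/

section Spectral

variable {E ι : Type*} [NormedAddCommGroup E] [InnerProductSpace ℂ E] [Fintype ι]

/-- The characteristic polynomial fixes the spectrum with multiplicity, and sorting leaves the
decreasing `w` unchanged; `b` need not be orthonormal. -/
theorem eigenvalues_eq_of_apply_basis [FiniteDimensional ℂ E] {n : ℕ} {T : E →ₗ[ℂ] E} (hT : T.IsSymmetric)
    (hn : Module.finrank ℂ E = n) (b : Module.Basis (Fin n) ℂ E) {w : Fin n → ℝ}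
    (hw : Antitone w) (h : ∀ j, T (b j) = (w j : ℂ) • b j) : hT.eigenvalues hn = w := by
  have hm : LinearMap.toMatrix b b T = Matrix.diagonal (fun j => (w j : ℂ)) := by
    ext i j
    rw [LinearMap.toMatrix_apply, h, map_smul, Finsupp.smul_apply, b.repr_self,
      Finsupp.single_apply, Matrix.diagonal_apply]
    by_cases hij : i = j
    · subst hij; simp
    · simp [hij, Ne.symm hij]
  have hr : T.charpoly.roots = Multiset.map (fun j => (w j : ℂ)) univ.val := by
    rw [← LinearMap.charpoly_toMatrix T b, hm, Matrix.charpoly_diagonal, Polynomial.roots_prod _ _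
      (by simp [Finset.prod_ne_zero_iff, Polynomial.X_sub_C_ne_zero])]
    simp
  have hs := hT.sort_roots_charpoly_eq_eigenvalues hn
  rw [← List.ofFn_inj, ← hs, hr]
  simp only [Fin.univ_val_map, Multiset.map_coe, List.map_ofFn, Function.comp_def,
    RCLike.re_to_complex, Complex.ofReal_re, Multiset.coe_sort]
  refine (List.mergeSort_of_pairwise ?_).symm ▸ rfl
  simp_rw [decide_eq_true_eq, ← List.sortedGE_iff_pairwise]
  exact hw.sortedGE_ofFn

/-- The operator which is diagonal in an orthonormal basis, with given real eigenvalues. -/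
def diagOp (b : OrthonormalBasis ι ℂ E) : (ι → ℝ) →ₗ[ℝ] (E →ₗ[ℂ] E) where
  toFun v := b.toBasis.constr ℂ fun i => (v i : ℂ) • b i
  map_add' v w := b.toBasis.ext fun i => by
    simp only [Module.Basis.constr_basis, LinearMap.add_apply, Pi.add_apply, Complex.ofReal_add,
      add_smul]
  map_smul' c v := b.toBasis.ext fun i => by
    simp only [Module.Basis.constr_basis, RingHom.id_apply, LinearMap.smul_apply, Pi.smul_apply,
      smul_eq_mul, Complex.ofReal_mul, mul_smul]
    rfl


theorem diagOp_apply_basis (b : OrthonormalBasis ι ℂ E) (v : ι → ℝ) (i : ι) :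
    diagOp b v (b i) = (v i : ℂ) • b i := by
  have := b.toBasis.constr_basis ℂ (fun i => (v i : ℂ) • b i) i
  simpa [diagOp] using this

theorem inner_diagOp (b : OrthonormalBasis ι ℂ E) (v : ι → ℝ) (x y : E) :
    inner ℂ x (diagOp b v y) = ∑ i, (v i : ℂ) * (inner ℂ x (b i) * inner ℂ (b i) y) := by
  conv_lhs => rw [← b.sum_repr' y]
  simp only [map_sum, map_smul, diagOp_apply_basis, inner_sum, inner_smul_right]
  refine sum_congr rfl fun i _ => ?_
  ring

theorem isPositive_diagOp (b : OrthonormalBasis ι ℂ E) {v : ι → ℝ} (hv : ∀ i, 0 ≤ v i) :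
    (diagOp b v).IsPositive := by
  have hs : (diagOp b v).IsSymmetric := fun x y => by
    rw [inner_diagOp, ← inner_conj_symm, inner_diagOp, map_sum]
    refine sum_congr rfl fun i _ => ?_
    simp only [map_mul, Complex.conj_ofReal, inner_conj_symm]
    ring
  refine ⟨hs, fun x => ?_⟩
  rw [hs, inner_diagOp, map_sum]
  refine sum_nonneg fun i _ => ?_
  rw [← inner_conj_symm x, RCLike.re_to_complex, Complex.re_ofReal_mul, mul_comm (starRingEnd ℂ _),
    Complex.mul_conj, Complex.ofReal_re]
  exact mul_nonneg (hv i) (Complex.normSq_nonneg _)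

theorem trace_diagOp (b : OrthonormalBasis ι ℂ E) (v : ι → ℝ) :
    LinearMap.trace ℂ E (diagOp b v) = ∑ i, (v i : ℂ) := by
  rw [LinearMap.trace_eq_sum_inner _ b]
  refine sum_congr rfl fun i _ => ?_
  rw [diagOp_apply_basis, inner_smul_right, b.inner_eq_one, mul_one]

theorem eq_diagOp_of_inner (b : OrthonormalBasis ι ℂ E) (T : E →ₗ[ℂ] E) {v : ι → ℝ}
    (h1 : ∀ i, inner ℂ (b i) (T (b i)) = v i) (h2 : ∀ i j, i ≠ j → inner ℂ (b i) (T (b j)) = 0) :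
    T = diagOp b v := by
  refine b.toBasis.ext fun j => ?_
  classical
  rw [b.coe_toBasis, diagOp_apply_basis]
  refine b.repr.injective (PiLp.ext fun i => ?_)
  simp only [OrthonormalBasis.repr_apply_apply, inner_smul_right, b.inner_eq_ite]
  by_cases hij : i = j
  · subst hij; simp [h1]
  · simp [h2 i j hij, hij]

/-- A variational bound on the sum of diagonal entries of a self-adjoint operator. -/
theorem sum_inner_le_of_eigenvalues [FiniteDimensional ℂ E] {n : ℕ} {T : E →ₗ[ℂ] E} (hT : T.IsSymmetric)
    (hn : Module.finrank ℂ E = n) (b : OrthonormalBasis ι ℂ E) (s : Finset ι) {θ : ℝ} :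
    ∑ i ∈ s, (inner ℂ (b i) (T (b i))).re ≤
      ∑ j, max (hT.eigenvalues hn j - θ) 0 + θ * s.card := by
  set w := hT.eigenvalues hn with hw
  set φ := hT.eigenvectorBasis hn with hφ
  have h1 : ∀ i, (inner ℂ (b i) (T (b i))).re = ∑ j, w j * ‖inner ℂ (b i) (φ j)‖ ^ 2 := fun i => by
    rw [← φ.sum_inner_mul_inner, Complex.re_sum]
    refine sum_congr rfl fun j _ => ?_
    rw [← hT, hT.apply_eigenvectorBasis, inner_smul_left, RCLike.conj_ofReal, mul_left_comm,
      ← inner_conj_symm _ (b i), Complex.mul_conj, Complex.normSq_eq_norm_sq]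
    exact Complex.re_ofReal_mul _ _
  have h2 : ∀ j, ∑ i ∈ s, ‖inner ℂ (b i) (φ j)‖ ^ 2 ≤ 1 := fun j => by
    have := b.orthonormal.sum_inner_products_le (φ j) (s := s)
    rwa [φ.norm_eq_one, one_pow] at this
  have h3 : ∑ j, ∑ i ∈ s, ‖inner ℂ (b i) (φ j)‖ ^ 2 = s.card := by
    rw [sum_comm]
    simp [φ.sum_sq_norm_inner_left]
  simp only [h1]
  rw [sum_comm, ← h3, mul_sum, ← sum_add_distrib]
  refine sum_le_sum fun j _ => ?_
  rw [← mul_sum]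
  have h0 : 0 ≤ ∑ i ∈ s, ‖inner ℂ (b i) (φ j)‖ ^ 2 := by positivity
  -- With `q` the sum of squares, `0 ≤ q ≤ 1` gives `w j * q ≤ max (w j - θ) 0 + θ * q`; the `q` sum
  -- to `s.card`.
  nlinarith [h2 j, le_max_left (w j - θ) 0, le_max_right (w j - θ) 0,
    mul_le_mul_of_nonneg_right (le_max_left (w j - θ) 0) h0,
    mul_le_mul_of_nonneg_left (h2 j) (le_max_right (w j - θ) 0)]

end Spectral

/-! ### Linear bounds on occupations, and mixtures of Slater determinants -/

/-- An upper bound for the diagonal of the one-particle reduced operator. -/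
theorem sum_mul_inner_oneRDM_le {w : Fin (d.choose N) → ℝ} {Γ : FermionOp N d}
    (hΓ : Γ ∈ wEnsembleStates w) (u : OrthonormalBasis (Fin d) ℂ (OneParticle d)) (c : Fin d → ℝ)
    {B θ : ℝ} (s : Finset (Config N d))
    (hc : ∀ I : Config N d, ∑ i ∈ I.1, c i ≤ B + if I ∈ s then 1 else 0) :
    ∑ i, c i * (inner ℂ (u i) (oneRDM Γ (u i))).re ≤ B + (∑ j, max (w j - θ) 0 + θ * s.card) := by
  obtain ⟨⟨hpos, htr⟩, hev⟩ := hΓ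
  have hk := sum_inner_le_of_eigenvalues hpos.isSymmetric (finrank_fermion N d) (slaterBasis N u) s
    (θ := θ)
  rw [hev] at hk
  have h0 : ∀ I, 0 ≤ (inner ℂ (slater u I) (Γ (slater u I))).re := fun I => by
    have := hpos.2 (slater u I)
    rwa [hpos.isSymmetric] at this
  have h1 : ∑ I, (inner ℂ (slater u I) (Γ (slater u I))).re = 1 := by
    have := congrArg Complex.re ((LinearMap.trace_eq_sum_inner Γ (slaterBasis N u)).symm.trans htr)
    simpa only [Complex.re_sum, slaterBasis_apply, Complex.one_re] using this
  calc ∑ i, c i * (inner ℂ (u i) (oneRDM Γ (u i))).re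
      = ∑ I : Config N d, (∑ i ∈ I.1, c i) * (inner ℂ (slater u I) (Γ (slater u I))).re := by
        simp only [inner_oneRDM_self, Complex.re_sum, mul_sum, sum_mul]
        rw [sum_comm]
        refine sum_congr rfl fun I _ => ?_
        rw [← sum_subset (subset_univ I.1)]
        · exact sum_congr rfl fun i hi => by rw [if_pos hi]
        · intro i _ hi
          rw [if_neg hi, Complex.zero_re, mul_zero]
    _ ≤ ∑ I : Config N d, (B + if I ∈ s then 1 else 0) *
          (inner ℂ (slater u I) (Γ (slater u I))).re :=
        sum_le_sum fun I _ => mul_le_mul_of_nonneg_right (hc I) (h0 I)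
    _ = B + ∑ I ∈ s, (inner ℂ (slater u I) (Γ (slater u I))).re := by
        simp only [add_mul, sum_add_distrib, ← mul_sum, h1, mul_one, ite_mul, one_mul, zero_mul]
        simp
    _ ≤ _ := by simpa using hk

theorem sum_mul_eigenvalues_le {w : Fin (d.choose N) → ℝ} {γ : OneParticleOp d}
    (hγ : γ ∈ relaxedWRepresentable w) (hs : γ.IsSymmetric) (c : Fin d → ℝ)
    {B θ : ℝ} (s : Finset (Config N d))
    (hc : ∀ I : Config N d, ∑ i ∈ I.1, c i ≤ B + if I ∈ s then 1 else 0) :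
    ∑ i, c i * hs.eigenvalues finrank_euclideanSpace_fin i ≤
      B + (∑ j, max (w j - θ) 0 + θ * s.card) := by
  set u := hs.eigenvectorBasis finrank_euclideanSpace_fin with hu
  let f : OneParticleOp d →ₗ[ℝ] ℝ :=
    { toFun := fun T => ∑ i, c i * (inner ℂ (u i) (T (u i))).re
      map_add' := fun S T => by simp [mul_add, sum_add_distrib]
      map_smul' := fun a T => by
        simp only [LinearMap.smul_apply, RingHom.id_apply, smul_eq_mul, mul_sum]
        refine sum_congr rfl fun i _ => ?_
        rw [inner_smul_right_eq_smul, Complex.smul_re, smul_eq_mul]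
        ring }
  have hmem : γ ∈ {T | f T ≤ B + (∑ j, max (w j - θ) 0 + θ * s.card)} := by
    refine convexHull_min ?_ (convex_halfSpace_le (f := f) f.isLinear _) hγ
    rintro _ ⟨Γ, hΓ, rfl⟩
    exact sum_mul_inner_oneRDM_le hΓ u c s hc
  have hf : f γ = ∑ i, c i * hs.eigenvalues finrank_euclideanSpace_fin i := by
    change ∑ i, c i * (inner ℂ (u i) (γ (u i))).re = _
    refine sum_congr rfl fun i _ => ?_
    rw [hs.apply_eigenvectorBasis, inner_smul_right, u.inner_eq_one]
    simp
  rw [← hf]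
  exact hmem

/-- The occupation numbers of a mixture of Slater determinants with weights `w`. -/
def occVector (w : Fin (d.choose N) → ℝ) (e : Fin (d.choose N) ≃ Config N d) (i : Fin d) : ℝ :=
  ∑ j, if i ∈ (e j).1 then w j else 0

theorem diagOp_occVector_mem {w : Fin (d.choose N) → ℝ} (hw : IsWeightVector w)
    (u : OrthonormalBasis (Fin d) ℂ (OneParticle d)) (e : Fin (d.choose N) ≃ Config N d) :
    diagOp u (occVector w e) ∈ wRepresentable w := by
  have happ := fun I => diagOp_apply_basis (slaterBasis N u) (fun I => w (e.symm I)) I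
  refine ⟨diagOp (slaterBasis N u) fun I => w (e.symm I), ⟨⟨isPositive_diagOp _ fun I =>
    hw.nonneg _, ?_⟩, ?_⟩, ?_⟩
  · refine (trace_diagOp (slaterBasis N u) _).trans ?_
    rw [Equiv.sum_comp e.symm (fun j => (w j : ℂ))]
    exact_mod_cast hw.sum_eq_one
  · refine eigenvalues_eq_of_apply_basis _ _ ((slaterBasis N u).toBasis.reindex e.symm) hw.antitone
      fun j => ?_
    have := happ (e j)
    simpa using this
  · simp only [slaterBasis_apply] at happ
    refine eq_diagOp_of_inner u _ (fun i => ?_) fun i j hij => inner_oneRDM_of_ne _ u happ hij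
    rw [inner_oneRDM_self, occVector, ← Equiv.sum_comp e]
    push_cast
    refine sum_congr rfl fun j _ => ?_
    rw [happ, fermion_inner_smul_right, inner_slater]
    rw [if_pos rfl, mul_one]
    split_ifs <;> simp

/-- `diagOp u` is real-linear, so it carries a hull of occupation vectors to a hull of representable
operators. -/
theorem mem_relaxedWRepresentable_of_eigenvalues {w : Fin (d.choose N) → ℝ}
    (hw : IsWeightVector w) {γ : OneParticleOp d} (hs : γ.IsSymmetric)
    (h : hs.eigenvalues finrank_euclideanSpace_fin ∈ convexHull ℝ (Set.range (occVector w))) :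
    γ ∈ relaxedWRepresentable w := by
  set u := hs.eigenvectorBasis finrank_euclideanSpace_fin with hu
  have hγ : γ = diagOp u (hs.eigenvalues finrank_euclideanSpace_fin) :=
    u.toBasis.ext fun i => by
      rw [OrthonormalBasis.coe_toBasis, diagOp_apply_basis, hs.apply_eigenvectorBasis]
      rfl
  have h2 := Set.mem_image_of_mem (diagOp u) h
  rw [LinearMap.image_convexHull, ← hγ] at h2
  refine convexHull_mono ?_ h2
  rintro _ ⟨_, ⟨e, rfl⟩, rfl⟩
  exact diagOp_occVector_mem hw u e

/-! ### Initial segments of orbitals and weight vectors -/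

/-- The first `k` one-particle indices. -/
def firstIndices (d k : ℕ) : Finset (Fin d) := univ.filter fun i => (i : ℕ) < k

@[simp]
theorem mem_firstIndices {k : ℕ} {i : Fin d} : i ∈ firstIndices d k ↔ (i : ℕ) < k := by
  simp [firstIndices]

theorem card_firstIndices {k : ℕ} (hk : k ≤ d) : (firstIndices d k).card = k := by
  rw [firstIndices, Fin.card_filter_val_lt, min_eq_right hk]

theorem firstIndices_succ {k : ℕ} (hk : k < d) :
    firstIndices d (k + 1) = insert ⟨k, hk⟩ (firstIndices d k) := by
  ext i
  simp only [mem_firstIndices, mem_insert, Fin.ext_iff]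
  omega

theorem sum_firstIndices_succ {k : ℕ} (hk : k < d) (v : Fin d → ℝ) :
    ∑ i ∈ firstIndices d (k + 1), v i = v ⟨k, hk⟩ + ∑ i ∈ firstIndices d k, v i := by
  rw [firstIndices_succ hk, sum_insert (by simp)]

theorem firstIndices_self : firstIndices d d = univ := by
  ext i; simp

theorem sum_Icc_entry (v : Fin d → ℝ) {k : ℕ} (hk : k ≤ d) :
    ∑ j ∈ Icc 1 k, entry v j = ∑ i ∈ firstIndices d k, v i := by
  symm
  refine sum_nbij (fun i => (i : ℕ) + 1) ?_ ?_ ?_ ?_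
  · intro i hi
    rw [mem_firstIndices] at hi
    simp only [mem_Icc]
    omega
  · intro i _ j _ h
    exact Fin.ext (by simpa using h)
  · intro j hj
    rw [coe_Icc, Set.mem_Icc] at hj
    exact ⟨⟨j - 1, by omega⟩, by simp; omega, by simp; omega⟩
  · intro i _
    simp [entry]

theorem entry_succ (v : Fin d → ℝ) {k : ℕ} (hk : k < d) : entry v (k + 1) = v ⟨k, hk⟩ := by
  rw [entry, dif_pos (by omega)]
  rfl

section Weights

variable {D : ℕ} {w : Fin D → ℝ}

theorem sum_max_sub_zeroth (hw : Antitone w) (h : 0 < D) :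
    ∑ j, max (w j - w ⟨0, h⟩) 0 = 0 :=
  sum_eq_zero fun _ _ => max_eq_right (sub_nonpos.2 (hw (Fin.mk_le_of_le_val (Nat.zero_le _))))

theorem sum_max_sub_first (hw : Antitone w) (h : 1 < D) :
    ∑ j, max (w j - w ⟨1, h⟩) 0 = w ⟨0, by omega⟩ - w ⟨1, h⟩ := by
  rw [sum_eq_single ⟨0, by omega⟩]
  · exact max_eq_left (sub_nonneg.2 (hw (Fin.mk_le_of_le_val (Nat.zero_le _))))
  · intro j _ hj
    refine max_eq_right (sub_nonpos.2 (hw (Fin.mk_le_of_le_val ?_)))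
    have : (j : ℕ) ≠ 0 := fun h => hj (Fin.ext h)
    change 1 ≤ (j : ℕ)
    omega
  · simp

theorem eq_zero_of_card_support (hw : IsWeightVector w)
    (hr : (univ.filter fun j => w j ≠ 0).card = 3) (j : Fin D) (hj : 3 ≤ (j : ℕ)) : w j = 0 := by
  by_contra h
  have hpos : 0 < w j := lt_of_le_of_ne (hw.nonneg j) (Ne.symm h)
  have hsub : firstIndices D 4 ⊆ univ.filter fun j => w j ≠ 0 := by
    intro i hi
    rw [mem_firstIndices] at hi
    have : i ≤ j := Fin.le_def.2 (by omega)
    simpa using (hpos.trans_le (hw.antitone this)).ne'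
  have := card_le_card hsub
  rw [hr, card_firstIndices (by omega)] at this
  omega

theorem three_le_of_card_support (hr : (univ.filter fun j => w j ≠ 0).card = 3) : 3 ≤ D := by
  have := card_le_univ (univ.filter fun j => w j ≠ 0)
  rwa [hr, Fintype.card_fin] at this

theorem sum_mul_of_card_support (hw : IsWeightVector w)
    (hr : (univ.filter fun j => w j ≠ 0).card = 3) (h : 3 ≤ D) (f : Fin D → ℝ) :
    ∑ j, w j * f j = w ⟨0, by omega⟩ * f ⟨0, by omega⟩ + w ⟨1, by omega⟩ * f ⟨1, by omega⟩ +
      w ⟨2, by omega⟩ * f ⟨2, by omega⟩ := by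
  rw [← sum_subset (subset_univ (firstIndices D 3))]
  · rw [sum_firstIndices_succ (by omega), sum_firstIndices_succ (by omega),
      sum_firstIndices_succ (by omega)]
    have : firstIndices D 0 = ∅ := by ext; simp
    rw [this, sum_empty]
    ring
  · intro j _ hj
    rw [mem_firstIndices, not_lt] at hj
    rw [eq_zero_of_card_support hw hr j hj, zero_mul]

end Weights

/-! ### Configurations near the Fermi level -/

theorem card_inter_firstIndices_le {k : ℕ} (hk : k ≤ d) (I : Finset (Fin d)) :
    (I ∩ firstIndices d k).card ≤ k :=
  (card_le_card inter_subset_right).trans (card_firstIndices hk).le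

/-- A configuration other than the lowest one occupies at most `N - 1` of the lowest `N` indices. -/
theorem card_inter_firstIndices (hN : N ≤ d) (I : Config N d) (hI : I.1 ≠ firstIndices d N) :
    (I.1 ∩ firstIndices d N).card + 1 ≤ N := by
  by_contra h
  have h1 := card_inter_firstIndices_le hN I.1
  have h2 : I.1 ∩ firstIndices d N = I.1 := eq_of_subset_of_card_le inter_subset_left (by
    rw [I.2]; omega)
  exact hI (eq_of_subset_of_card_le (inter_eq_left.1 h2) (by rw [I.2, card_firstIndices hN]))

/-- The sum is at most `2 * K + 1`, with equality only if `I` contains the lowest `K` indices and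
lies within the lowest `K + 2`; just two configurations do so. -/
theorem card_inter_add_card_inter {K : ℕ} (hK : K + 1 < d) (I : Config (K + 1) d)
    (h1 : I.1 ≠ insert ⟨K, by omega⟩ (firstIndices d K))
    (h2 : I.1 ≠ insert ⟨K + 1, hK⟩ (firstIndices d K)) :
    (I.1 ∩ firstIndices d K).card + (I.1 ∩ firstIndices d (K + 2)).card ≤ 2 * K := by
  by_contra h
  have h3 := card_inter_firstIndices_le (show K ≤ d by omega) I.1
  have h4 : (I.1 ∩ firstIndices d (K + 2)).card ≤ K + 1 :=
    (card_le_card inter_subset_left).trans I.2.le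
  have h5 : I.1 ∩ firstIndices d (K + 2) = I.1 := eq_of_subset_of_card_le inter_subset_left (by
    rw [I.2]; omega)
  have h6 : I.1 ∩ firstIndices d K = firstIndices d K :=
    eq_of_subset_of_card_le inter_subset_right (by rw [card_firstIndices (by omega)]; omega)
  have h7 : (I.1 \ firstIndices d K).card = 1 := by
    rw [card_sdiff_of_subset (inter_eq_right.1 h6), I.2, card_firstIndices (by omega)]
    omega
  obtain ⟨a, ha⟩ := card_eq_one.1 h7
  have hI : I.1 = insert a (firstIndices d K) := by
    rw [insert_eq, ← ha, sdiff_union_of_subset (inter_eq_right.1 h6)]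
  have haI : a ∈ I.1 \ firstIndices d K := by rw [ha]; simp
  rw [mem_sdiff, mem_firstIndices] at haI
  have ha2 := inter_eq_left.1 h5 haI.1
  rw [mem_firstIndices] at ha2
  have : a = ⟨K, by omega⟩ ∨ a = ⟨K + 1, hK⟩ := by
    simp only [Fin.ext_iff]; omega
  rcases this with h | h
  · exact h1 (h ▸ hI)
  · exact h2 (h ▸ hI)

theorem sum_eq_firstIndices_add {K : ℕ} (hK : K + 1 < d) (v : Fin d → ℝ) :
    ∑ i, v i = ∑ i ∈ firstIndices d K, v i + v ⟨K, by omega⟩ + v ⟨K + 1, hK⟩ +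
      ∑ i ∈ (firstIndices d (K + 2))ᶜ, v i := by
  rw [← sum_add_sum_compl (firstIndices d (K + 2)) v, sum_firstIndices_succ hK,
    sum_firstIndices_succ (show K < d by omega)]
  ring

/-- A linear functional evaluated at occupation numbers in `[0, 1]` is bounded in terms of the
occupation numbers near the Fermi level. -/
theorem sum_mul_le_fermi_level {K : ℕ} (hK : K + 1 < d) {l c : Fin d → ℝ} (h0 : ∀ i, 0 ≤ l i)
    (h1 : ∀ i, l i ≤ 1) {x y : ℝ} (hx : ∀ i : Fin d, (i : ℕ) < K → x ≤ c i)
    (hy : ∀ i : Fin d, K + 2 ≤ (i : ℕ) → c i ≤ y) :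
    ∑ i, c i * l i ≤ ∑ i ∈ firstIndices d K, c i + x * (∑ i ∈ firstIndices d K, l i - K) +
      c ⟨K, by omega⟩ * l ⟨K, by omega⟩ + c ⟨K + 1, hK⟩ * l ⟨K + 1, hK⟩ +
      y * ∑ i ∈ (firstIndices d (K + 2))ᶜ, l i := by
  rw [sum_eq_firstIndices_add hK]
  have hcard : (K : ℝ) = ∑ i ∈ firstIndices d K, 1 := by
    rw [sum_const, card_firstIndices (by omega)]; simp
  have hl : ∑ i ∈ firstIndices d K, c i * l i ≤
      ∑ i ∈ firstIndices d K, c i + x * (∑ i ∈ firstIndices d K, l i - K) := by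
    rw [hcard, ← sum_sub_distrib, mul_sum, ← sum_add_distrib]
    refine sum_le_sum fun i hi => ?_
    -- The termwise inequality is `(c i - x) * (1 - l i) ≥ 0`.
    nlinarith [mul_nonneg (sub_nonneg.2 (hx i (mem_firstIndices.1 hi))) (sub_nonneg.2 (h1 i))]
  have hr : ∑ i ∈ (firstIndices d (K + 2))ᶜ, c i * l i ≤
      y * ∑ i ∈ (firstIndices d (K + 2))ᶜ, l i := by
    rw [mul_sum]
    refine sum_le_sum fun i hi => mul_le_mul_of_nonneg_right (hy i ?_) (h0 i)
    simpa using hi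
  linarith

/-- The configuration of the `K` lowest indices and one more. -/
def addOne {K : ℕ} (a : Fin d) (ha : K ≤ (a : ℕ)) : Config (K + 1) d :=
  ⟨insert a (firstIndices d K), by
    rw [card_insert_of_notMem (by simpa using ha), card_firstIndices (by omega)]⟩

/-- The configuration of the `K + 2` lowest indices without the index `K - 1`. -/
def removeOne {K : ℕ} (h0 : K ≠ 0) (hK : K + 1 < d) : Config (K + 1) d :=
  ⟨insert ⟨K + 1, hK⟩ (insert ⟨K, by omega⟩ (firstIndices d (K - 1))), by
    rw [card_insert_of_notMem, card_insert_of_notMem, card_firstIndices (by omega)]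
    · omega
    · rw [mem_firstIndices]
      change ¬ K < K - 1
      omega
    · rw [mem_insert, mem_firstIndices, Fin.mk.injEq]
      change ¬ (K + 1 = K ∨ K + 1 < K - 1)
      omega⟩

theorem sum_addOne {K : ℕ} (a : Fin d) (ha : K ≤ (a : ℕ)) (c : Fin d → ℝ) :
    ∑ i ∈ (addOne a ha).1, c i = ∑ i ∈ firstIndices d K, c i + c a := by
  rw [addOne, sum_insert (by simpa using ha), add_comm]

theorem sum_removeOne {K : ℕ} (h0 : K ≠ 0) (hK : K + 1 < d) (c : Fin d → ℝ) :
    ∑ i ∈ (removeOne h0 hK).1, c i =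
      ∑ i ∈ firstIndices d K, c i - c ⟨K - 1, by omega⟩ + c ⟨K, by omega⟩ + c ⟨K + 1, hK⟩ := by
  obtain ⟨k, rfl⟩ := Nat.exists_eq_add_one_of_ne_zero h0
  rw [removeOne, sum_insert (by simp; omega), sum_insert (by simp),
    sum_firstIndices_succ (show k < d by omega)]
  simp only [Nat.add_sub_cancel]
  ring

theorem addOne_injective {K : ℕ} {a b : Fin d} {ha : K ≤ (a : ℕ)} {hb : K ≤ (b : ℕ)}
    (h : addOne a ha = addOne b hb) : a = b := by
  have : a ∈ (addOne b hb).1 := h ▸ mem_insert_self a _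
  rcases mem_insert.1 this with h | h
  · exact h
  · rw [mem_firstIndices] at h
    omega

theorem addOne_ne_removeOne {K : ℕ} (h0 : K ≠ 0) (hK : K + 1 < d) (a : Fin d)
    (ha : K ≤ (a : ℕ)) : addOne a ha ≠ removeOne h0 hK := by
  intro h
  have : (⟨K - 1, by omega⟩ : Fin d) ∈ (removeOne h0 hK).1 :=
    h ▸ mem_insert_of_mem (mem_firstIndices.2 (show K - 1 < K by omega))
  simp only [removeOne, mem_insert, mem_firstIndices, Fin.ext_iff] at this
  omega

/-- Linear programming duality in explicit form: the gap is bounded below by a nonnegative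
combination of the constraints. The third configuration is chosen by comparing `c` at `K - 1` and `K
+ 2` with `c` at `K` and `K + 1`. -/
theorem exists_configs_ge {K : ℕ} (hK : K + 1 < d) (hd : K = 0 → K + 2 < d) {l c : Fin d → ℝ}
    (hc : Antitone c) (h0 : ∀ i, 0 ≤ l i) (h1 : ∀ i, l i ≤ 1) (hs : ∑ i, l i = K + 1)
    {w₀ w₁ w₂ : ℝ} (hw : w₀ + w₁ + w₂ = 1)
    (h2 : ∑ i ∈ firstIndices d K, l i + l ⟨K, by omega⟩ ≤ K + w₀)
    (h3 : 2 * ∑ i ∈ firstIndices d K, l i + l ⟨K, by omega⟩ + l ⟨K + 1, hK⟩ ≤ 2 * K + w₀ + w₁) :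
    ∃ A B C : Config (K + 1) d, A ≠ B ∧ A ≠ C ∧ B ≠ C ∧
      ∑ i, c i * l i ≤ w₀ * ∑ i ∈ A.1, c i + w₁ * ∑ i ∈ B.1, c i + w₂ * ∑ i ∈ C.1, c i := by
  have hA : K ≤ ((⟨K, by omega⟩ : Fin d) : ℕ) := le_rfl
  have hB : K ≤ ((⟨K + 1, hK⟩ : Fin d) : ℕ) := Nat.le_succ K
  have hAB : addOne _ hA ≠ addOne _ hB := fun h => by
    have := Fin.mk.inj_iff.1 (addOne_injective h)
    omega
  rw [sum_eq_firstIndices_add hK] at hs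
  have hR : 0 ≤ ∑ i ∈ (firstIndices d (K + 2))ᶜ, l i := sum_nonneg fun i _ => h0 i
  have hm : c ⟨K + 1, hK⟩ ≤ c ⟨K, by omega⟩ := hc (Fin.mk_le_mk.2 (Nat.le_succ K))
  have hbound := fun x y hx hy => sum_mul_le_fermi_level hK (c := c) h0 h1 (x := x) (y := y) hx hy
  set cp := c ⟨K, by omega⟩
  set cq := c ⟨K + 1, hK⟩
  set lp := l ⟨K, by omega⟩
  set lq := l ⟨K + 1, hK⟩
  set L := ∑ i ∈ firstIndices d K, l i
  set R := ∑ i ∈ (firstIndices d (K + 2))ᶜ, l i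
  set S := ∑ i ∈ firstIndices d K, c i with hS
  have key1 : ∀ x y, (∀ i : Fin d, (i : ℕ) < K → x ≤ c i) →
      (∀ i : Fin d, K + 2 ≤ (i : ℕ) → c i ≤ y) → y ≤ cq → cp + cq ≤ x + y →
      ∑ i, c i * l i ≤ w₀ * (S + cp) + w₁ * (S + cq) + w₂ * (S + y) := by
    intro x y hx hy hyq hxy
    have hL : L ≤ K := by
      have hcard : (K : ℝ) = ∑ i ∈ firstIndices d K, 1 := by
        rw [sum_const, card_firstIndices (by omega)]; simp
      rw [hcard]
      exact sum_le_sum fun i _ => h1 i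
    refine (hbound x y hx hy).trans ?_
    obtain rfl : w₂ = 1 - w₀ - w₁ := by linarith
    obtain hRe : R = K + 1 - L - lp - lq := by linarith
    rw [hRe]
    -- The three products add up exactly to the difference of the two sides.
    have e1 := mul_nonneg (show 0 ≤ x + y - cp - cq by linarith) (sub_nonneg.2 hL)
    have e2 := mul_nonneg (sub_nonneg.2 hm) (sub_nonneg.2 h2)
    have e3 := mul_nonneg (sub_nonneg.2 hyq) (sub_nonneg.2 h3)
    linarith
  have key2 : ∀ x y, (∀ i : Fin d, (i : ℕ) < K → x ≤ c i) →
      (∀ i : Fin d, K + 2 ≤ (i : ℕ) → c i ≤ y) → cp ≤ x → x + y ≤ cp + cq →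
      ∑ i, c i * l i ≤ w₀ * (S + cp) + w₁ * (S + cq) + w₂ * (S - x + cp + cq) := by
    intro x y hx hy hxp hxy
    refine (hbound x y hx hy).trans ?_
    obtain rfl : w₂ = 1 - w₀ - w₁ := by linarith
    have e1 := mul_nonneg (show 0 ≤ cp + cq - x - y by linarith) hR
    have e2 := mul_nonneg (sub_nonneg.2 hm) (sub_nonneg.2 h2)
    have e3 := mul_nonneg (sub_nonneg.2 hxp) (sub_nonneg.2 h3)
    obtain hRe : R = K + 1 - L - lp - lq := by linarith
    rw [hRe] at e1 ⊢
    linarith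
  have hx : ∀ (h : K ≠ 0) (i : Fin d), (i : ℕ) < K → c ⟨K - 1, by omega⟩ ≤ c i := fun h i hi =>
    hc (Fin.le_def.2 (show (i : ℕ) ≤ K - 1 by omega))
  have hy : ∀ (h : K + 2 < d) (i : Fin d), K + 2 ≤ (i : ℕ) → c i ≤ c ⟨K + 2, h⟩ := fun h i hi =>
    hc (Fin.le_def.2 hi)
  have case1 : ∀ (h : K + 2 < d) (x : ℝ), (∀ i : Fin d, (i : ℕ) < K → x ≤ c i) →
      cp + cq ≤ x + c ⟨K + 2, h⟩ → ∃ A B C : Config (K + 1) d, A ≠ B ∧ A ≠ C ∧ B ≠ C ∧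
      ∑ i, c i * l i ≤ w₀ * ∑ i ∈ A.1, c i + w₁ * ∑ i ∈ B.1, c i + w₂ * ∑ i ∈ C.1, c i := by
    intro h x hx1 hx2
    refine ⟨addOne _ hA, addOne _ hB, addOne ⟨K + 2, h⟩ (Nat.le_add_right K 2), hAB, ?_, ?_, ?_⟩
    · intro h
      have := Fin.mk.inj_iff.1 (addOne_injective h)
      omega
    · intro h
      have := Fin.mk.inj_iff.1 (addOne_injective h)
      omega
    · rw [sum_addOne, sum_addOne, sum_addOne]
      exact key1 x _ hx1 (hy h) (hc (Fin.mk_le_mk.2 (by omega))) hx2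
  have case2 : ∀ (h : K ≠ 0) (y : ℝ), (∀ i : Fin d, K + 2 ≤ (i : ℕ) → c i ≤ y) →
      c ⟨K - 1, by omega⟩ + y ≤ cp + cq → ∃ A B C : Config (K + 1) d, A ≠ B ∧ A ≠ C ∧ B ≠ C ∧
      ∑ i, c i * l i ≤ w₀ * ∑ i ∈ A.1, c i + w₁ * ∑ i ∈ B.1, c i + w₂ * ∑ i ∈ C.1, c i := by
    intro h y hy1 hy2
    refine ⟨addOne _ hA, addOne _ hB, removeOne h hK, hAB, addOne_ne_removeOne h hK _ _,
      addOne_ne_removeOne h hK _ _, ?_⟩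
    rw [sum_addOne, sum_addOne, sum_removeOne]
    exact key2 _ y (hx h) hy1 (hc (Fin.mk_le_mk.2 (by omega))) hy2
  by_cases hK0 : K = 0
  -- No orbital lies below index 0, so `x` is free and chosen to make the comparison an equality.
  · exact case1 (hd hK0) (cp + cq - c ⟨K + 2, hd hK0⟩) (fun i hi => by omega) (by linarith)
  by_cases hKd : K + 2 < d
  · rcases le_total (cp + cq) (c ⟨K - 1, by omega⟩ + c ⟨K + 2, hKd⟩) with h | h
    · exact case1 hKd _ (hx hK0) h
    · exact case2 hK0 _ (hy hKd) h
  -- Here `d = K + 2`: no orbital lies above, so `y` is free.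
  · exact case2 hK0 (cp + cq - c ⟨K - 1, by omega⟩) (fun i hi => by omega) (by linarith)

/-! ### The separation argument -/

/-- The configuration obtained by relabelling the one-particle indices. -/
def Config.map (τ : Equiv.Perm (Fin d)) (I : Config N d) : Config N d :=
  ⟨I.1.map τ.toEmbedding, by rw [card_map, I.2]⟩

theorem Config.map_injective (τ : Equiv.Perm (Fin d)) :
    Function.Injective (Config.map (N := N) τ) := fun _ _ h =>
  Subtype.ext (Finset.map_injective _ (congrArg Subtype.val h))

/-- Only the first three positions carry weight in the application, so the rest of the bijection is
arbitrary. -/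
theorem exists_equiv_config (h : 3 ≤ d.choose N) {A B C : Config N d} (hAB : A ≠ B) (hAC : A ≠ C)
    (hBC : B ≠ C) : ∃ e : Fin (d.choose N) ≃ Config N d,
      e ⟨0, by omega⟩ = A ∧ e ⟨1, by omega⟩ = B ∧ e ⟨2, by omega⟩ = C := by
  set f : Fin (d.choose N) → Config N d := fun j =>
    if (j : ℕ) = 0 then A else if (j : ℕ) = 1 then B else C with hf
  have hinj : Set.InjOn f (firstIndices (d.choose N) 3) := by
    intro i hi j hj hij
    rw [mem_coe, mem_firstIndices] at hi hj
    apply Fin.ext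
    simp only [hf] at hij
    split_ifs at hij <;> first | omega | simp_all
  obtain ⟨e, he⟩ := Finset.exists_equiv_extend_of_card_eq (t := univ) (by simp) (subset_univ _) hinj
  refine ⟨e.trans (Equiv.subtypeUnivEquiv mem_univ), ?_, ?_, ?_⟩
  · exact he _ (mem_firstIndices.2 (show 0 < 3 by omega))
  · exact he _ (mem_firstIndices.2 (show 1 < 3 by omega))
  · exact he _ (mem_firstIndices.2 (show 2 < 3 by omega))

theorem mem_convexHull_occVector {K : ℕ} (hK : K + 1 < d) (hd : K = 0 → K + 2 < d)
    {w : Fin (d.choose (K + 1)) → ℝ} (hw : IsWeightVector w)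
    (hr : (univ.filter fun j => w j ≠ 0).card = 3) (hD : 3 ≤ d.choose (K + 1)) {l : Fin d → ℝ}
    (hl : Antitone l) (h0 : ∀ i, 0 ≤ l i) (h1 : ∀ i, l i ≤ 1) (hs : ∑ i, l i = K + 1)
    (h2 : ∑ i ∈ firstIndices d K, l i + l ⟨K, by omega⟩ ≤ K + w ⟨0, by omega⟩)
    (h3 : 2 * ∑ i ∈ firstIndices d K, l i + l ⟨K, by omega⟩ + l ⟨K + 1, hK⟩ ≤
      2 * K + w ⟨0, by omega⟩ + w ⟨1, by omega⟩) :
    l ∈ convexHull ℝ (Set.range (occVector w)) := by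
  by_contra hmem
  obtain ⟨f, t, hf, ht⟩ := geometric_hahn_banach_closed_point (convex_convexHull ℝ _)
    ((Set.finite_range (occVector w)).isClosed_convexHull ℝ) hmem
  set c : Fin d → ℝ := fun i => f (Pi.single i 1) with hc
  have hfc : ∀ v, f v = ∑ i, c i * v i := fun v => by
    conv_lhs => rw [pi_eq_sum_univ' v]
    simp [hc, mul_comm]
  have hfe : ∀ e : Fin (d.choose (K + 1)) ≃ Config (K + 1) d, w ⟨0, by omega⟩ * ∑ i ∈ (e ⟨0, by omega⟩).1, c i +
      w ⟨1, by omega⟩ * ∑ i ∈ (e ⟨1, by omega⟩).1, c i +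
      w ⟨2, by omega⟩ * ∑ i ∈ (e ⟨2, by omega⟩).1, c i < t := fun e => by
    rw [← sum_mul_of_card_support hw hr hD fun j => ∑ i ∈ (e j).1, c i]
    refine lt_of_eq_of_lt ?_ (hf _ (subset_convexHull ℝ _ ⟨e, rfl⟩))
    simp only [hfc, occVector, mul_sum]
    rw [sum_comm]
    refine sum_congr rfl fun j _ => ?_
    rw [← sum_subset (subset_univ (e j).1)]
    · exact sum_congr rfl fun i hi => by rw [if_pos hi, mul_comm]
    · intro i _ hi
      rw [if_neg hi, mul_zero]
  set τ : Equiv.Perm (Fin d) := Tuple.sort (fun i => -c i) with hτ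
  have hcτ : Antitone (c ∘ τ) := fun i j hij => by
    have := Tuple.monotone_sort (fun i => -c i) hij
    simpa using this
  -- Rearrangement inequality: since `l` is decreasing, sorting `c` decreasingly can only increase
  -- the pairing.
  have hre : ∑ i, c i * l i ≤ ∑ i, (c ∘ τ) i * l i := by
    have hmono : Monovary l (c ∘ τ) := hl.monovary hcτ
    have := hmono.sum_mul_comp_perm_le_sum_mul (σ := τ⁻¹)
    simpa [mul_comm] using this
  have hw1 : w ⟨0, by omega⟩ + w ⟨1, by omega⟩ + w ⟨2, by omega⟩ = 1 := by
    have := sum_mul_of_card_support hw hr hD 1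
    simpa [hw.sum_eq_one] using this.symm
  obtain ⟨A, B, C, hAB, hAC, hBC, hle⟩ := exists_configs_ge hK hd hcτ h0 h1 hs hw1 h2 h3
  -- The configurations were found for the sorted functional; relabelling by `τ` returns them to the
  -- original `c`.
  have hinj := Config.map_injective (N := K + 1) τ
  obtain ⟨e, hA, hB, hC⟩ := exists_equiv_config hD (hinj.ne hAB) (hinj.ne hAC) (hinj.ne hBC)
  have hlt := hfe e
  rw [hA, hB, hC] at hlt
  simp only [Config.map, sum_map, Equiv.coe_toEmbedding] at hlt
  rw [hfc] at ht
  simp only [Function.comp_apply] at hle hre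
  linarith

/-! ### Necessity of the inequalities -/

theorem sum_ite_mem_firstIndices (v : Fin d → ℝ) (k : ℕ) :
    ∑ i, (if i ∈ firstIndices d k then 1 else 0) * v i = ∑ i ∈ firstIndices d k, v i := by
  simp only [ite_mul, one_mul, zero_mul, sum_ite_mem, univ_inter]

theorem sum_config_ite_mem (I : Finset (Fin d)) (k : ℕ) :
    ∑ i ∈ I, (if i ∈ firstIndices d k then 1 else 0 : ℝ) = ((I ∩ firstIndices d k).card : ℝ) := by
  rw [sum_boole, filter_mem_eq_inter]

theorem inequalities_of_mem_relaxedWRepresentable {K : ℕ} (hK : K + 1 < d)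
    {w : Fin (d.choose (K + 1)) → ℝ} (hw : IsWeightVector w) (hD : 1 < d.choose (K + 1))
    {γ : OneParticleOp d} (hs : γ.IsSymmetric) (hγ : γ ∈ relaxedWRepresentable w)
    {l : Fin d → ℝ} (hl : hs.eigenvalues finrank_euclideanSpace_fin = l) :
    ∑ i, l i = K + 1 ∧ (∀ i, l i ≤ 1) ∧
      ∑ i ∈ firstIndices d (K + 1), l i ≤ K + w ⟨0, by omega⟩ ∧
      ∑ i ∈ firstIndices d K, l i + ∑ i ∈ firstIndices d (K + 2), l i ≤
        2 * K + w ⟨0, by omega⟩ + w ⟨1, by omega⟩ := by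
  have key := fun c B θ s hc => sum_mul_eigenvalues_le hγ hs c (B := B) (θ := θ) s hc
  rw [hl] at key
  -- With `s = ∅` and `θ` the largest weight, the spectral term vanishes.
  have key0 : ∀ (c : Fin d → ℝ) (B : ℝ), (∀ I : Config (K + 1) d, ∑ i ∈ I.1, c i ≤ B) →
      ∑ i, c i * l i ≤ B := fun c B hc => by
    have := key c B (w ⟨0, by omega⟩) ∅ (by simpa using hc)
    simpa [sum_max_sub_zeroth hw.antitone] using this
  refine ⟨le_antisymm ?_ ?_, fun i => ?_, ?_, ?_⟩
  · have := key0 1 (K + 1) fun I => by simp [I.2]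
    simpa using this
  · have := key0 (-1) (-(K + 1)) fun I => by simp [I.2]
    simp at this
    linarith
  · have := key0 (Pi.single i 1) 1 fun I => by
      simp only [Pi.single_apply, sum_ite_eq']
      split_ifs <;> norm_num
    simpa [Pi.single_apply] using this
  · have := key (fun i => if i ∈ firstIndices d (K + 1) then 1 else 0) K (w ⟨0, by omega⟩)
      {⟨firstIndices d (K + 1), card_firstIndices (by omega)⟩} fun I => by
        rw [sum_config_ite_mem]
        by_cases hI : I.1 = firstIndices d (K + 1)
        · rw [if_pos (mem_singleton.2 (Subtype.ext hI))]
          exact_mod_cast card_inter_firstIndices_le (by omega) I.1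
        · have h := card_inter_firstIndices (by omega) I hI
          have h2 : (I.1 ∩ firstIndices d (K + 1)).card ≤ K := by omega
          refine (Nat.cast_le.2 h2).trans (le_add_of_nonneg_right ?_)
          split_ifs <;> norm_num
    rw [sum_ite_mem_firstIndices, sum_max_sub_zeroth hw.antitone] at this
    simpa using this
  · have hA : K ≤ ((⟨K, by omega⟩ : Fin d) : ℕ) := le_rfl
    have hB : K ≤ ((⟨K + 1, hK⟩ : Fin d) : ℕ) := Nat.le_succ K
    -- Coefficients are 2 below `K`, 1 at `K` and `K + 1`, 0 above. With `θ = w₂` in the numbering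
    -- from one and two exceptional configurations, the spectral term is `(w₁ - w₂) + 2 w₂ = w₁ +
    -- w₂`.
    have := key (fun i => (if i ∈ firstIndices d K then 1 else 0) +
      (if i ∈ firstIndices d (K + 2) then 1 else 0)) (2 * K) (w ⟨1, hD⟩)
      {addOne _ hA, addOne _ hB} fun I => by
        rw [sum_add_distrib, sum_config_ite_mem, sum_config_ite_mem]
        by_cases hI : I ∈ ({addOne _ hA, addOne _ hB} : Finset (Config (K + 1) d))
        · rw [if_pos hI]
          have h1 := card_inter_firstIndices_le (show K ≤ d by omega) I.1
          have h2 : (I.1 ∩ firstIndices d (K + 2)).card ≤ K + 1 :=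
            (card_le_card inter_subset_left).trans I.2.le
          have h3 : (I.1 ∩ firstIndices d K).card + (I.1 ∩ firstIndices d (K + 2)).card ≤
            2 * K + 1 := by omega
          exact_mod_cast h3
        · rw [if_neg hI, add_zero]
          simp only [mem_insert, mem_singleton, not_or] at hI
          have h := card_inter_add_card_inter hK I (fun h => hI.1 (Subtype.ext h))
            fun h => hI.2 (Subtype.ext h)
          exact_mod_cast h
    simp only [add_mul, sum_add_distrib, sum_ite_mem_firstIndices] at this
    rw [sum_max_sub_first hw.antitone hD, card_pair] at this
    · push_cast at this
      linarith
    · intro h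
      have := Fin.mk.inj_iff.1 (addOne_injective h)
      omega

end RDMFT

end

theorem mainTheorem3 (N d : ℕ) (w : Fin (d.choose N) → ℝ) (hw : RDMFT.IsWeightVector w)
    (hr : (Finset.univ.filter fun j => w j ≠ 0).card = 3)
    (γ : RDMFT.OneParticleOp d) (hγ : γ.IsPositive) :
    γ ∈ RDMFT.relaxedWRepresentable w ↔
      (∑ j ∈ Finset.Icc 1 d, RDMFT.occ hγ.isSymmetric j = (N : ℝ)) ∧
      RDMFT.occ hγ.isSymmetric 1 ≤ 1 ∧
      (∑ j ∈ Finset.Icc 1 N, RDMFT.occ hγ.isSymmetric j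
        ≤ (N : ℝ) - 1 + RDMFT.entry w 1) ∧
      (2 * ∑ j ∈ Finset.Icc 1 (N - 1), RDMFT.occ hγ.isSymmetric j
          + RDMFT.occ hγ.isSymmetric N
          + RDMFT.occ hγ.isSymmetric (N + 1)
        ≤ 2 * ((N : ℝ) - 1) + RDMFT.entry w 1 + RDMFT.entry w 2) := by
  have hD := RDMFT.three_le_of_card_support hr
  obtain ⟨K, rfl⟩ : ∃ K, N = K + 1 := by
    refine Nat.exists_eq_add_one_of_ne_zero fun h => ?_
    subst h
    simp at hD
  have hK : K + 1 < d := by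
    by_contra h
    rcases (not_lt.1 h).eq_or_lt with h | h
    · subst h
      simp at hD
    · simp [Nat.choose_eq_zero_of_lt h] at hD
  -- For one particle, `3 ≤ d.choose 1` says `3 ≤ d`: the third configuration must add an orbital,
  -- as none can be removed.
  have hd : K = 0 → K + 2 < d := by
    rintro rfl
    simp at hD
    omega
  set l := hγ.isSymmetric.eigenvalues finrank_euclideanSpace_fin with hl
  have hocc : ∀ k, RDMFT.occ hγ.isSymmetric k = RDMFT.entry l k := fun _ => rfl
  have hanti : Antitone l := hγ.isSymmetric.eigenvalues_antitone _
  have hnonneg : ∀ i, 0 ≤ l i := hγ.nonneg_eigenvalues _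
  have hc1 : ((K + 1 : ℕ) : ℝ) - 1 = K := by push_cast; ring
  have e1 : RDMFT.entry l 1 = l ⟨0, by omega⟩ := RDMFT.entry_succ l (by omega)
  have ew1 : RDMFT.entry w 1 = w ⟨0, by omega⟩ := RDMFT.entry_succ w (by omega)
  have ew2 : RDMFT.entry w 2 = w ⟨1, by omega⟩ := RDMFT.entry_succ w (by omega)
  simp only [hocc]
  rw [RDMFT.sum_Icc_entry l le_rfl, RDMFT.sum_Icc_entry l hK.le, Nat.add_sub_cancel,
    RDMFT.sum_Icc_entry l (show K ≤ d by omega), RDMFT.entry_succ l (show K < d by omega),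
    RDMFT.entry_succ l hK, RDMFT.firstIndices_self, e1, ew1, ew2, hc1, Nat.cast_add_one]
  constructor
  · intro h
    obtain ⟨h1, h2, h3, h4⟩ :=
      RDMFT.inequalities_of_mem_relaxedWRepresentable hK hw (by omega) hγ.isSymmetric h hl.symm
    rw [RDMFT.sum_firstIndices_succ hK,
      RDMFT.sum_firstIndices_succ (show K < d by omega)] at h4
    exact ⟨h1, h2 _, h3, by linarith⟩
  · rintro ⟨h1, h2, h3, h4⟩
    rw [RDMFT.sum_firstIndices_succ (show K < d by omega)] at h3
    refine RDMFT.mem_relaxedWRepresentable_of_eigenvalues hw hγ.isSymmetric ?_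
    rw [← hl]
    exact RDMFT.mem_convexHull_occVector hK hd hw hr hD hanti hnonneg
      (fun i => (hanti (Fin.mk_le_of_le_val (Nat.zero_le _))).trans h2) h1 (by linarith) h4
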